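/- Let $G$ be a finite chordal graph (every cycle of length at least four has a chord) on $n$ vertices, and let $v_1,\ldots,v_n$ be a perfect elimination order of $G$, that is, an ordering of the vertices such that for each $m\in\{1,\ldots,n\}$ the neighbours of $v_m$ among $v_1,\ldots,v_{m-1}$ form a clique. For $0\le m\le n$ let $G_m$ be the subgraph of $G$ induced by $v_1,\ldots,v_m$. For a finite graph $H$ and an integer $k\ge 0$, let ${H \brace k}$ (the graph Stirling number of the second kind) be the number of partitions of the vertex set of $H$ into exactly $k$ non-empty independent sets. Then the matrix $S_G=\left[{G_m \brace k}\right]_{m,k=0}^n$ is totally non-negative, that is, every minor (determinant of a square submatrix) of $S_G$ is non-negative. -/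

import Mathlib

/-- A graph is chordal if every cycle of length at least four has a chord (an edge of the graph
joining two vertices of the cycle that is not an edge of the cycle). -/
def SimpleGraph.IsChordal {V : Type*} (G : SimpleGraph V) : Prop :=
  ∀ (u : V) (p : G.Walk u u), p.IsCycle → 4 ≤ p.length → ∃ e : Sym2 V, p.IsChord e

/-- The enumeration `v 0, …, v (n - 1)` of the vertices of `G` is a perfect elimination order:
for every `m`, the neighbours of `v m` among the earlier vertices form a clique. -/
def SimpleGraph.IsPerfectEliminationOrder {V : Type*} (G : SimpleGraph V) {n : ℕ}
    (v : Fin n ≃ V) : Prop :=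
  ∀ m : Fin n, G.IsClique (v '' {j | j < m ∧ G.Adj (v m) (v j)})

/-- The graph Stirling number of the second kind of a (finite) graph `G`: the number of partitions
of the vertex set into exactly `k` non-empty independent sets. -/
noncomputable def SimpleGraph.stirlingSecond {V : Type*} (G : SimpleGraph V) (k : ℕ) : ℕ :=
  {c : Set (Set V) | Setoid.IsPartition c ∧ c.encard = k ∧ ∀ B ∈ c, G.IsIndepSet B}.ncard

/-- The subgraph of `G` induced by the first `m` vertices of the enumeration `v`. -/
def SimpleGraph.initialInduce {V : Type*} (G : SimpleGraph V) {n : ℕ} (v : Fin n ≃ V) (m : ℕ) :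
    SimpleGraph (v '' {i : Fin n | (i : ℕ) < m}) :=
  G.induce (v '' {i : Fin n | (i : ℕ) < m})

/-- The matrix of graph Stirling numbers of the second kind, with rows and columns indexed by
`0, 1, …, n`. -/
noncomputable def SimpleGraph.stirlingMatrix {V : Type*} (G : SimpleGraph V) {n : ℕ}
    (v : Fin n ≃ V) : Matrix (Fin (n + 1)) (Fin (n + 1)) ℝ :=
  Matrix.of fun m k => ((G.initialInduce v (m : ℕ)).stirlingSecond (k : ℕ) : ℝ)

/-- A matrix is totally non-negative if all of its minors (determinants of square submatrices,
the rows and columns being taken in increasing order) are non-negative. -/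
def Matrix.IsTotallyNonneg {p q : ℕ} (M : Matrix (Fin p) (Fin q) ℝ) : Prop :=
  ∀ (l : ℕ) (r : Fin l ↪o Fin p) (s : Fin l ↪o Fin q), 0 ≤ (M.submatrix r s).det

/-! Let `a m` be the number of earlier neighbours of the vertex with index m. They form a clique, so
they lie in distinct blocks of every admissible partition of the earlier vertices. Hence S(m+1, k) =
S(m, k-1) + (k - a m) S(m, k), the recurrence for the coefficients of ∏_{i<m} (X - a i) in the
falling factorial basis (`ncard_properSetoids_eq_connectionCoeff`).

The weights k - a m may be negative, so the recurrence alone does not give total non-negativity.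
However, the elimination order forces `a` to have restricted growth
(`isRestrictedGrowth_backDegree`). Deleting a repeated term of least value writes the array of `a`
as a non-negative bidiagonal matrix times the array of the shorter sequence
(`isTotallyNonnegArray_connectionCoeff_of_skip`). Once no repetition is left, `a` is the identity
and so is the array. -/

/-! ### Totally non-negative arrays and bidiagonal factors -/

/-- An infinite matrix is totally non-negative if all of its finite minors are non-negative. -/
def IsTotallyNonnegArray (T : ℕ → ℕ → ℝ) : Prop :=
  ∀ (l : ℕ) (r s : Fin l → ℕ), StrictMono r → StrictMono s →
    0 ≤ (Matrix.of fun i j => T (r i) (s j)).det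

/-- Left multiplication by a non-negative lower bidiagonal matrix with unit diagonal preserves
total non-negativity. -/
theorem IsTotallyNonnegArray.of_bidiagonal {T T' : ℕ → ℕ → ℝ} (hT' : IsTotallyNonnegArray T')
    (w : ℕ → ℝ) (hw : ∀ m, 0 ≤ w m)
    (h : ∀ m k, T m k = T' m k + w m * T' (m - 1) k) (hw0 : w 0 = 0) :
    IsTotallyNonnegArray T := by
  classical
  intro l r s hr hs
  let A : Fin l → Fin l → ℝ := fun i j => T' (r i) (s j)
  let B : Fin l → Fin l → ℝ := fun i j => w (r i) * T' (r i - 1) (s j)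
  have hAB : (Matrix.of fun i j => T (r i) (s j)) = (A + B : Fin l → Fin l → ℝ) := by
    ext i j
    simp [A, B, h]
  -- Multilinear expansion: `t` is the set of rows that keep index `r i`; the others drop to `r i -
  -- 1`.
  have hsum := (Matrix.detRowAlternating (n := Fin l) (R := ℝ)).map_add_univ A B
  rw [hAB]
  change 0 ≤ Matrix.detRowAlternating (A + B)
  rw [hsum]
  refine Finset.sum_nonneg fun t _ => ?_
  let c : Fin l → ℝ := fun i => if i ∈ t then 1 else w (r i)
  let ρ : Fin l → ℕ := fun i => if i ∈ t then r i else r i - 1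
  have hpw : t.piecewise A B = fun i => c i • fun j => T' (ρ i) (s j) := by
    ext i j
    by_cases hi : i ∈ t <;> simp [Finset.piecewise, hi, A, B, c, ρ]
  rw [hpw, AlternatingMap.map_smul_univ]
  have hc : 0 ≤ ∏ i, c i := Finset.prod_nonneg fun i _ => by
    by_cases hi : i ∈ t <;> simp [c, hi, hw]
  by_cases hz : ∃ i, r i = 0 ∧ i ∉ t
  · obtain ⟨i, hi, hit⟩ := hz
    have : ∏ i, c i = 0 := Finset.prod_eq_zero (Finset.mem_univ i) (by simp [c, hit, hi, hw0])
    simp [this]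
  push Not at hz
  refine mul_nonneg hc ?_
  change 0 ≤ Matrix.det (Matrix.of fun i j => T' (ρ i) (s j))
  -- Lowering some terms of a strictly increasing sequence by one keeps it weakly increasing, so
  -- each term is a minor of `T'` or has two equal rows.
  have hmono : Monotone ρ := by
    intro i j hij
    rcases hij.eq_or_lt with rfl | hlt
    · exact le_rfl
    · have := hr hlt
      simp only [ρ]
      split_ifs <;> omega
  by_cases hinj : Function.Injective ρ
  · exact hT' l ρ s (hmono.strictMono_of_injective hinj) hs
  · simp only [Function.Injective, not_forall] at hinj
    obtain ⟨i, j, hij, hne⟩ := hinj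
    rw [Matrix.det_zero_of_row_eq hne (by ext k; simp [hij])]

/-! ### Connection coefficients and deletion of a term -/

/-- The connection coefficients from the products `∏ i < m, (X - a i)` to the falling
factorials. -/
def connectionCoeff (a : ℕ → ℕ) : ℕ → ℕ → ℝ
  | 0, 0 => 1
  | 0, _ + 1 => 0
  | m + 1, 0 => (0 - a m) * connectionCoeff a m 0
  | m + 1, k + 1 => connectionCoeff a m k + ((k + 1 : ℕ) - a m) * connectionCoeff a m (k + 1)

theorem connectionCoeff_congr {a b : ℕ → ℕ} {m : ℕ} (h : ∀ i < m, a i = b i) (k : ℕ) :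
    connectionCoeff a m k = connectionCoeff b m k := by
  induction m generalizing k with
  | zero => cases k <;> simp [connectionCoeff]
  | succ m ih =>
    have hm := h m m.lt_succ_self
    have ih' := ih fun i hi => h i (hi.trans m.lt_succ_self)
    cases k <;> simp [connectionCoeff, hm, ih']

theorem connectionCoeff_id (m k : ℕ) :
    connectionCoeff id m k = if m = k then 1 else 0 := by
  induction m generalizing k with
  | zero => cases k <;> simp [connectionCoeff]
  | succ m ih =>
    cases k with
    | zero =>
      simp only [connectionCoeff, ih]
      split_ifs with h
      all_goals simp_all
    | succ k =>
      simp only [connectionCoeff, ih]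
      by_cases h : m = k + 1
      · simp [h]
      · simp [h]

/-- The strictly increasing map `ℕ → ℕ` omitting exactly the value `j`. -/
def skip (j m : ℕ) : ℕ := if m < j then m else m + 1

theorem skip_strictMono (j : ℕ) : StrictMono (skip j) := by
  intro a b h
  simp only [skip]
  split_ifs <;> omega

theorem skip_ne (j m : ℕ) : skip j m ≠ j := by
  simp only [skip]
  split_ifs <;> omega

theorem exists_skip_eq {j m : ℕ} (h : m ≠ j) : ∃ p, skip j p = m := by
  rcases h.lt_or_gt with h | h
  · exact ⟨m, by simp [skip, h]⟩
  · exact ⟨m - 1, by simp only [skip]; split_ifs <;> omega⟩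

/-- This is X - a j = (X - a (m+1)) + (a (m+1) - a j), multiplied by the product of the X - a i over
i ≤ m, i ≠ j. -/
theorem connectionCoeff_comp_skip (a : ℕ → ℕ) {j m : ℕ} (hm : j ≤ m) (k : ℕ) :
    connectionCoeff a (m + 1) k = connectionCoeff (a ∘ skip j) (m + 1) k +
      ((a (m + 1) : ℝ) - a j) * connectionCoeff (a ∘ skip j) m k := by
  have hs : ∀ m, j ≤ m → skip j m = m + 1 := fun m hm => by simp [skip, hm]
  induction m, hm using Nat.le_induction generalizing k with
  | base =>
    have h : ∀ k, connectionCoeff a j k = connectionCoeff (a ∘ skip j) j k :=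
      connectionCoeff_congr fun i hi => by simp [skip, hi]
    cases k with
    | zero =>
      simp only [connectionCoeff, h, Function.comp, hs j le_rfl]
      ring
    | succ k =>
      simp only [connectionCoeff, h, Function.comp, hs j le_rfl]
      ring
  | succ m hm ih =>
    have e1 : (a ∘ skip j) m = a (m + 1) := by simp [hs m hm]
    have e2 : (a ∘ skip j) (m + 1) = a (m + 1 + 1) := by simp [hs (m + 1) (by omega)]
    cases k with
    | zero =>
      have h1 : connectionCoeff a (m + 1 + 1) 0 = (0 - a (m + 1)) * connectionCoeff a (m + 1) 0 :=
        rfl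
      have h2 : connectionCoeff (a ∘ skip j) (m + 1 + 1) 0 =
        (0 - (a ∘ skip j) (m + 1) : ℝ) * connectionCoeff (a ∘ skip j) (m + 1) 0 := rfl
      have h3 : connectionCoeff (a ∘ skip j) (m + 1) 0 =
        (0 - (a ∘ skip j) m : ℝ) * connectionCoeff (a ∘ skip j) m 0 := rfl
      rw [e1] at h3
      rw [e2] at h2
      rw [h1, h2, ih]
      linear_combination ((a j : ℝ) - a (m + 1)) * h3
    | succ k =>
      have h1 : connectionCoeff a (m + 1 + 1) (k + 1) = connectionCoeff a (m + 1) k +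
        ((k + 1 : ℕ) - a (m + 1)) * connectionCoeff a (m + 1) (k + 1) := rfl
      have h2 : connectionCoeff (a ∘ skip j) (m + 1 + 1) (k + 1) =
        connectionCoeff (a ∘ skip j) (m + 1) k + ((k + 1 : ℕ) - (a ∘ skip j) (m + 1) : ℝ) *
          connectionCoeff (a ∘ skip j) (m + 1) (k + 1) := rfl
      have h3 : connectionCoeff (a ∘ skip j) (m + 1) (k + 1) =
        connectionCoeff (a ∘ skip j) m k + ((k + 1 : ℕ) - (a ∘ skip j) m : ℝ) *
          connectionCoeff (a ∘ skip j) m (k + 1) := rfl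
      rw [e1] at h3
      rw [e2] at h2
      rw [h1, h2, ih, ih]
      linear_combination ((a j : ℝ) - a (m + 1)) * h3

theorem isTotallyNonnegArray_connectionCoeff_of_skip (a : ℕ → ℕ) (j : ℕ)
    (hj : ∀ m, j < m → a j ≤ a m)
    (h : IsTotallyNonnegArray (connectionCoeff (a ∘ skip j))) :
    IsTotallyNonnegArray (connectionCoeff a) := by
  refine h.of_bidiagonal (fun m => if j < m then (a m : ℝ) - a j else 0) ?_ ?_ (by simp)
  · intro m
    split_ifs with hm
    · exact sub_nonneg.2 (by exact_mod_cast hj m hm)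
    · exact le_rfl
  · intro m k
    split_ifs with hm
    · obtain ⟨m, rfl⟩ : ∃ p, m = p + 1 := ⟨m - 1, by omega⟩
      exact connectionCoeff_comp_skip a (by omega) k
    · rw [zero_mul, add_zero]
      refine connectionCoeff_congr (fun i hi => ?_) k
      simp [skip, show i < j by omega]

/-- If every chosen row index is a chosen column index, the two increasing selections coincide and
the minor is 1; otherwise it has a zero row. -/
theorem isTotallyNonnegArray_one :
    IsTotallyNonnegArray fun m k => if m = k then 1 else 0 := by
  intro l r s hr hs
  by_cases h : ∀ i, ∃ j, r i = s j
  · choose σ hσ using h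
    have hσm : StrictMono σ := fun i j hij => hs.lt_iff_lt.1 (by rw [← hσ, ← hσ]; exact hr hij)
    have hid : σ = id := funext fun i => by
      have h1 := hσm.le_apply (x := i)
      have : StrictMono (fun i => σ i) := hσm
      have := Subsingleton.elim (this.orderIsoOfSurjective _
        (Finite.surjective_of_injective hσm.injective)) (OrderIso.refl _)
      exact DFunLike.congr_fun this i
    have : (Matrix.of fun i j => if r i = s j then (1 : ℝ) else 0) = 1 := by
      ext i j
      have := hσ i
      simp only [hid, id] at this
      simp [Matrix.one_apply, this, hs.injective.eq_iff]
    rw [this, Matrix.det_one]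
    exact zero_le_one
  · push Not at h
    obtain ⟨i, hi⟩ := h
    rw [Matrix.det_eq_zero_of_row_eq_zero i (by simpa using hi)]

/-! ### Restricted growth sequences -/

/-- A sequence of natural numbers has restricted growth if every number below a term has
appeared before that term. -/
def IsRestrictedGrowth (a : ℕ → ℕ) : Prop :=
  ∀ m, ∀ x < a m, ∃ i < m, a i = x

theorem IsRestrictedGrowth.comp_skip {a : ℕ → ℕ} (ha : IsRestrictedGrowth a) {i j : ℕ}
    (hij : i < j) (h : a i = a j) : IsRestrictedGrowth (a ∘ skip j) := by
  intro m x hx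
  obtain ⟨p, hp, hpx⟩ := ha _ x hx
  obtain ⟨q, hq, hqj, hqx⟩ : ∃ q < skip j m, q ≠ j ∧ a q = x := by
    by_cases hpj : p = j
    · subst hpj
      exact ⟨i, hij.trans hp, hij.ne, h.trans hpx⟩
    · exact ⟨p, hp, hpj, hpx⟩
  obtain ⟨q, rfl⟩ := exists_skip_eq hqj
  exact ⟨q, (skip_strictMono j).lt_iff_lt.1 hq, hqx⟩

theorem IsRestrictedGrowth.eq_id {a : ℕ → ℕ} (ha : IsRestrictedGrowth a)
    (hinj : Function.Injective a) : a = id := by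
  funext m
  induction m using Nat.strong_induction_on with
  | _ m ih =>
    rcases lt_trichotomy (a m) m with h | h | h
    · exact absurd (hinj (ih _ h)) h.ne
    · exact h
    · obtain ⟨i, hi, him⟩ := ha m m h
      rw [ih i hi] at him
      exact absurd him hi.ne

theorem IsRestrictedGrowth.isTotallyNonnegArray_connectionCoeff {a : ℕ → ℕ}
    (ha : IsRestrictedGrowth a) (hfin : {j | ∃ i < j, a i = a j}.Finite) :
    IsTotallyNonnegArray (connectionCoeff a) := by
  induction hN : {j | ∃ i < j, a i = a j}.ncard using Nat.strong_induction_on generalizing a with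
  | _ N ih =>
    subst hN
    rcases {j | ∃ i < j, a i = a j}.eq_empty_or_nonempty with he | hne
    · have hinj : Function.Injective a := by
        intro i j hij
        by_contra hne
        rcases Ne.lt_or_gt hne with h | h
        · exact Set.eq_empty_iff_forall_notMem.1 he j ⟨i, h, hij⟩
        · exact Set.eq_empty_iff_forall_notMem.1 he i ⟨j, h, hij.symm⟩
      rw [ha.eq_id hinj, show connectionCoeff id = fun m k => if m = k then 1 else 0 from
        funext₂ connectionCoeff_id]
      exact isTotallyNonnegArray_one
    -- `j` is a repetition of least value, not the first one. A later `a m < a j` would already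
    -- occur before `j`, making `m` a repetition of smaller value.
    · obtain ⟨j, ⟨i, hij, hi⟩, hmin⟩ := Set.exists_min_image _ a hfin hne
      refine isTotallyNonnegArray_connectionCoeff_of_skip a j (fun m hm => ?_) ?_
      · by_contra! hlt
        obtain ⟨p, hp, hpm⟩ := ha j _ hlt
        exact absurd (hmin m ⟨p, hp.trans hm, hpm⟩) (by omega)
      · have hsub : skip j '' {q | ∃ p < q, (a ∘ skip j) p = (a ∘ skip j) q} ⊂
            {j | ∃ i < j, a i = a j} := by
          refine (Set.ssubset_iff_of_subset ?_).2 ⟨j, ⟨i, hij, hi⟩, ?_⟩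
          · rintro _ ⟨q, ⟨p, hpq, hp⟩, rfl⟩
            exact ⟨skip j p, skip_strictMono j hpq, hp⟩
          · rintro ⟨q, -, hq⟩
            exact skip_ne j q hq
        have hinj := (skip_strictMono j).injective
        refine ih _ ?_ (ha.comp_skip hij hi)
          ((hfin.subset hsub.subset).of_finite_image hinj.injOn) rfl
        rw [← Set.ncard_image_of_injective _ hinj]
        exact Set.ncard_lt_ncard hsub hfin

/-- The initial segment of a restricted growth sequence extends to a restricted growth sequence
with only finitely many repetitions. -/
theorem IsRestrictedGrowth.exists_extension {a : ℕ → ℕ} (ha : IsRestrictedGrowth a) (n : ℕ) :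
    ∃ b : ℕ → ℕ, IsRestrictedGrowth b ∧ {j | ∃ i < j, b i = b j}.Finite ∧ ∀ i < n, b i = a i := by
  let M := (Finset.range n).sup fun i => a i + 1
  have hM : ∀ i < n, a i < M := fun i hi =>
    Finset.le_sup (f := fun i => a i + 1) (Finset.mem_range.2 hi)
  -- Past `n` the sequence runs through the fresh values M, M + 1, ...; all values below `M` occur
  -- before `n`.
  let b : ℕ → ℕ := fun i => if i < n then a i else M + (i - n)
  have hb : ∀ i < n, b i = a i := fun i hi => if_pos hi
  have hb' : ∀ i, n ≤ i → b i = M + (i - n) := fun i hi => if_neg hi.not_gt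
  refine ⟨b, fun m x hx => ?_, (Set.finite_lt_nat n).subset ?_, hb⟩
  · by_cases hm : m < n
    · rw [hb m hm] at hx
      obtain ⟨i, hi, hix⟩ := ha m x hx
      exact ⟨i, hi, by rw [hb i (hi.trans hm), hix]⟩
    · push Not at hm
      rw [hb' m hm] at hx
      by_cases hxM : x < M
      · obtain ⟨i, hi, hxi⟩ := Finset.lt_sup_iff.1 hxM
        rw [Finset.mem_range] at hi
        rcases (Nat.lt_succ_iff.1 hxi).eq_or_lt with h | h
        · exact ⟨i, by omega, by rw [hb i hi, h]⟩
        · obtain ⟨p, hp, hpx⟩ := ha i x h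
          exact ⟨p, by omega, by rw [hb p (hp.trans hi), hpx]⟩
      · exact ⟨n + (x - M), by omega, by rw [hb' _ (by omega)]; omega⟩
  · rintro j ⟨i, hij, h⟩
    by_contra hj
    rw [Set.mem_ofPred_eq, not_lt] at hj
    rw [hb' j hj] at h
    by_cases hi : i < n
    · have := hM i hi
      rw [hb i hi] at h
      omega
    · rw [hb' i (by omega)] at h
      omega

/-! ### Partitions as equivalence relations, and adding a vertex -/

/-- The equivalence relations with `k` classes none of which contains adjacent vertices. -/
def SimpleGraph.properSetoids {W : Type*} (H : SimpleGraph W) (k : ℕ) : Set (Setoid W) :=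
  {r | (∀ x y, H.Adj x y → ¬ r x y) ∧ Nat.card (Quotient r) = k}

theorem SimpleGraph.stirlingSecond_eq_ncard_properSetoids {W : Type*} [Finite W]
    (H : SimpleGraph W) (k : ℕ) : H.stirlingSecond k = (H.properSetoids k).ncard := by
  symm
  refine Set.ncard_congr (fun r _ => r.classes) ?_ ?_ ?_
  · rintro r ⟨hr, hk⟩
    refine ⟨r.isPartition_classes, ?_, ?_⟩
    · rw [← hk, ← ENat.card_coe_set_eq, ← ENat.card_congr (Setoid.quotientEquivClasses r),
        ENat.card_eq_coe_natCard]
    · rintro _ ⟨y, rfl⟩ a ha b hb - hab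
      exact hr a b hab (r.trans' ha (r.symm' hb))
  · exact fun r s _ _ h => Setoid.classes_inj.2 h
  · rintro c ⟨hc, hk, hi⟩
    refine ⟨Setoid.mkClasses c hc.2, ⟨?_, ?_⟩, Setoid.classes_mkClasses c hc⟩
    · intro x y hxy hr
      rw [Setoid.rel_iff_exists_classes] at hr
      obtain ⟨b, hb, hx, hy⟩ := hr
      rw [Setoid.classes_mkClasses c hc] at hb
      exact hi b hb hx hy hxy.ne hxy
    · rw [Nat.card_congr (Setoid.quotientEquivClasses _), Setoid.classes_mkClasses c hc]
      change c.ncard = k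
      rw [Set.ncard, hk]
      rfl

theorem SimpleGraph.Iso.ncard_properSetoids {W W' : Type*} {H : SimpleGraph W}
    {H' : SimpleGraph W'} (e : H ≃g H') (k : ℕ) :
    (H.properSetoids k).ncard = (H'.properSetoids k).ncard := by
  refine Set.ncard_congr (fun r _ => r.comap e.symm) ?_ ?_ ?_
  · rintro r ⟨hr, hk⟩
    refine ⟨fun x y hxy => hr _ _ (e.symm.map_adj_iff.2 hxy), hk ▸ ?_⟩
    refine Nat.card_congr (Quotient.congr e.symm.toEquiv fun x y => Iff.rfl)
  · intro r s _ _ h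
    ext x y
    simpa [Setoid.comap_rel] using congrArg (fun t : Setoid _ => t (e x) (e y)) h
  · rintro r ⟨hr, hk⟩
    refine ⟨r.comap e, ⟨fun x y hxy => hr _ _ (e.map_adj_iff.2 hxy), hk ▸ ?_⟩, ?_⟩
    · exact Nat.card_congr (Quotient.congr e.toEquiv fun x y => Iff.rfl)
    · ext x y
      simp [Setoid.comap_rel]

instance Setoid.finite_of_finite {W : Type*} [Finite W] : Finite (Setoid W) :=
  Finite.of_injective (fun r : Setoid W => r.classes) fun _ _ h => Setoid.classes_inj.2 h

/-- The map extending the quotient map of a setoid on `Fin m` by placing the last element of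
`Fin (m + 1)` in a class of its own (`none`) or in the given class. -/
def Setoid.extendMap {m : ℕ} (r : Setoid (Fin m)) (o : Option (Quotient r)) :
    Fin (m + 1) → Option (Quotient r) :=
  Fin.lastCases o fun i => some (Quotient.mk r i)

@[simp]
theorem Setoid.extendMap_last {m : ℕ} (r : Setoid (Fin m)) (o : Option (Quotient r)) :
    r.extendMap o (Fin.last m) = o := by simp [Setoid.extendMap]

@[simp]
theorem Setoid.extendMap_castSucc {m : ℕ} (r : Setoid (Fin m)) (o : Option (Quotient r))
    (i : Fin m) : r.extendMap o i.castSucc = some (Quotient.mk r i) := by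
  simp [Setoid.extendMap]

theorem Setoid.comap_ker_extendMap {m : ℕ} (r : Setoid (Fin m)) (o : Option (Quotient r)) :
    (Setoid.ker (r.extendMap o)).comap Fin.castSucc = r := by
  ext x y
  simp [Setoid.ker_def, Quotient.eq]

theorem Setoid.ker_extendMap_injective {m : ℕ} (r : Setoid (Fin m)) :
    Function.Injective fun o => Setoid.ker (r.extendMap o) := by
  intro o o' h
  have key : ∀ i : Fin m, o = some (Quotient.mk r i) ↔ o' = some (Quotient.mk r i) := fun i => by
    simpa [Setoid.ker_def] using 
      congrArg (fun t : Setoid _ => t (Fin.last m) i.castSucc) h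
  refine Option.ext fun q => ?_
  induction q using Quotient.inductionOn with
  | h i => exact key i

theorem Setoid.exists_ker_extendMap_eq {m : ℕ} (r : Setoid (Fin (m + 1))) :
    ∃ o, Setoid.ker ((r.comap Fin.castSucc).extendMap o) = r := by
  classical
  by_cases h : ∃ i : Fin m, r (Fin.last m) i.castSucc
  · obtain ⟨i, hi⟩ := h
    refine ⟨some (Quotient.mk _ i), ?_⟩
    have hl : ∀ j : Fin m, r i.castSucc j.castSucc ↔ r (Fin.last m) j.castSucc := fun j =>
      ⟨fun h => r.trans' hi h, fun h => r.trans' (r.symm' hi) h⟩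
    ext x y
    induction x using Fin.lastCases <;> induction y using Fin.lastCases <;>
      simp [Setoid.ker_def, Quotient.eq, Setoid.comap_rel, hl]
    rw [r.comm', hl, r.comm']
  · push Not at h
    refine ⟨none, ?_⟩
    ext x y
    induction x using Fin.lastCases <;> induction y using Fin.lastCases <;>
      simp [Setoid.ker_def, Quotient.eq, Setoid.comap_rel, h]
    rw [r.comm']
    exact h _

theorem Setoid.card_quotient_ker_extendMap {m : ℕ} (r : Setoid (Fin m))
    (o : Option (Quotient r)) : Nat.card (Quotient (Setoid.ker (r.extendMap o))) =
      Nat.card (Quotient r) + if o = none then 1 else 0 := by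
  rw [Nat.card_congr (Setoid.quotientKerEquivRange _)]
  cases o with
  | none =>
    have : Set.range (r.extendMap none) = Set.univ := by
      refine Set.eq_univ_of_forall fun o => ?_
      cases o with
      | none => exact ⟨Fin.last m, by simp⟩
      | some q =>
        induction q using Quotient.inductionOn with
        | h i => exact ⟨i.castSucc, by simp⟩
    rw [this, Nat.card_congr (Equiv.Set.univ _), Finite.card_option]
    simp
  | some q =>
    have : Set.range (r.extendMap (some q)) = Set.range some := by
      ext o
      constructor
      · rintro ⟨x, rfl⟩
        induction x using Fin.lastCases <;> simp
      · rintro ⟨q, rfl⟩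
        induction q using Quotient.inductionOn with
        | h i => exact ⟨i.castSucc, by simp⟩
    rw [this]
    simp [← Nat.card_congr (Equiv.ofInjective _ (Option.some_injective (Quotient r)))]

/-- The number of ways to extend a proper partition by a new vertex whose neighbours form a
clique. -/
theorem SimpleGraph.ncard_properSetoids_fiber {m : ℕ} (H : SimpleGraph (Fin (m + 1)))
    (hH : H.IsClique {j | j < Fin.last m ∧ H.Adj (Fin.last m) j}) (k : ℕ) (r : Setoid (Fin m))
    (hr : ∀ x y, (H.comap Fin.castSucc).Adj x y → ¬ r x y) :
    (({s ∈ H.properSetoids k | s.comap Fin.castSucc = r}.ncard : ℕ) : ℝ) =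
      (if Nat.card (Quotient r) + 1 = k then 1 else 0) +
      if Nat.card (Quotient r) = k then
        (k : ℝ) - ({j : Fin m | H.Adj (Fin.last m) j.castSucc}.ncard : ℕ) else 0 := by
  classical
  -- `D` is the set of blocks forbidden to the new vertex. Its neighbours are pairwise adjacent,
  -- hence in distinct blocks, so `D` is as large as the neighbourhood.
  set D : Set (Quotient r) := Quotient.mk r '' {j : Fin m | H.Adj (Fin.last m) j.castSucc} with hD
  have hDcard : D.ncard = {j : Fin m | H.Adj (Fin.last m) j.castSucc}.ncard := by
    refine Set.InjOn.ncard_image fun x hx y hy hxy => ?_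
    by_contra hne
    refine hr x y ?_ (Quotient.exact hxy)
    exact hH ⟨x.castSucc_lt_last, hx⟩ ⟨y.castSucc_lt_last, hy⟩
      fun h => hne (Fin.castSucc_injective _ h)
  have hfib : {s ∈ H.properSetoids k | s.comap Fin.castSucc = r} =
      (fun o => Setoid.ker (r.extendMap o)) '' {o | (∀ q ∈ D, o ≠ some q) ∧
        Nat.card (Quotient r) + (if o = none then 1 else 0) = k} := by
    ext s
    constructor
    · rintro ⟨⟨hs, hk⟩, rfl⟩
      obtain ⟨o, ho⟩ := s.exists_ker_extendMap_eq
      refine ⟨o, ⟨?_, ?_⟩, ho⟩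
      · rintro _ ⟨j, hj, rfl⟩ rfl
        refine hs _ _ hj ?_
        rw [← ho]
        simp [Setoid.ker_def]
      · rw [← Setoid.card_quotient_ker_extendMap, ho, hk]
    · rintro ⟨o, ⟨ho, hk⟩, rfl⟩
      refine ⟨⟨?_, ?_⟩, r.comap_ker_extendMap o⟩
      · intro x y hxy
        induction x using Fin.lastCases with
        | last =>
          induction y using Fin.lastCases with
          | last => exact absurd hxy (H.loopless.irrefl _)
          | cast y => simpa [Setoid.ker_def] using ho _ ⟨y, hxy, rfl⟩
        | cast x =>
          induction y using Fin.lastCases with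
          | last => simpa [Setoid.ker_def] using fun h => ho _ ⟨x, hxy.symm, rfl⟩ h.symm
          | cast y => simpa [Setoid.ker_def, Quotient.eq] using hr x y hxy
      · exact (r.card_quotient_ker_extendMap o).trans hk
  rw [hfib, Set.ncard_image_of_injective _ r.ker_extendMap_injective, ← hDcard]
  by_cases h1 : Nat.card (Quotient r) + 1 = k
  · have : {o : Option (Quotient r) | (∀ q ∈ D, o ≠ some q) ∧
        Nat.card (Quotient r) + (if o = none then 1 else 0) = k} = {none} := by
      ext o
      cases o with
      | none => simp [h1, -Nat.card_eq_fintype_card]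
      | some q => simp [show Nat.card (Quotient r) ≠ k by omega, -Nat.card_eq_fintype_card]
    rw [this, Set.ncard_singleton, if_pos h1, if_neg (by omega)]
    simp
  · by_cases h2 : Nat.card (Quotient r) = k
    · have : {o : Option (Quotient r) | (∀ q ∈ D, o ≠ some q) ∧
          Nat.card (Quotient r) + (if o = none then 1 else 0) = k} = some '' Dᶜ := by
        ext o
        cases o with
        | none => simp [h1, -Nat.card_eq_fintype_card]
        | some q =>
          simp only [Set.mem_ofPred_eq, ne_eq, Option.some.injEq, reduceCtorEq, if_false, add_zero,
            h2, and_true, Set.mem_image, Set.mem_compl_iff, exists_eq_right]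
          exact ⟨fun h hq => h q hq rfl, fun h p hp hqp => h (hqp ▸ hp)⟩
      rw [this, Set.ncard_image_of_injective _ (Option.some_injective _), if_neg h1, if_pos h2,
        ← h2, ← Set.ncard_add_ncard_compl D]
      push_cast
      ring
    · have : {o : Option (Quotient r) | (∀ q ∈ D, o ≠ some q) ∧
          Nat.card (Quotient r) + (if o = none then 1 else 0) = k} = ∅ := by
        ext o
        cases o <;> simp [h1, h2, -Nat.card_eq_fintype_card]
      rw [this, if_neg h1, if_neg h2]
      simp

/-- Sums the fibre counts over the restrictions to the first `m` vertices. The condition with `+ 1 =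
k` avoids truncated subtraction at `k = 0`, where that set is empty. -/
theorem SimpleGraph.ncard_properSetoids_succ {m : ℕ} (H : SimpleGraph (Fin (m + 1)))
    (hH : H.IsClique {j | j < Fin.last m ∧ H.Adj (Fin.last m) j}) (k : ℕ) :
    ((H.properSetoids k).ncard : ℝ) =
      {r ∈ {r : Setoid (Fin m) | ∀ x y, (H.comap Fin.castSucc).Adj x y → ¬ r x y} |
        Nat.card (Quotient r) + 1 = k}.ncard +
      ((k : ℝ) - ({j : Fin m | H.Adj (Fin.last m) j.castSucc}.ncard : ℕ)) *
        ((H.comap Fin.castSucc).properSetoids k).ncard := by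
  classical
  have := Fintype.ofFinite (Setoid (Fin m))
  have := Fintype.ofFinite (Setoid (Fin (m + 1)))
  set P : Finset (Setoid (Fin m)) :=
    {r | ∀ x y, (H.comap Fin.castSucc).Adj x y → ¬ r x y} with hP
  have hsum : (H.properSetoids k).ncard =
      ∑ r ∈ P, {s ∈ H.properSetoids k | s.comap Fin.castSucc = r}.ncard := by
    rw [Set.ncard_eq_toFinset_card', Finset.card_eq_sum_card_fiberwise
      (f := fun s => s.comap Fin.castSucc) (t := P)]
    · refine Finset.sum_congr rfl fun r _ => ?_
      rw [Set.ncard_eq_toFinset_card']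
      congr 1
      ext s
      simp
    · intro s hs
      rw [Finset.mem_coe, Set.mem_toFinset] at hs
      simp only [hP, Finset.coe_filter, Finset.mem_univ, true_and, Set.mem_ofPred_eq]
      exact fun x y hxy => hs.1 _ _ hxy
  rw [hsum, Nat.cast_sum, Finset.sum_congr rfl fun r hr =>
    H.ncard_properSetoids_fiber hH k r (Finset.mem_filter.1 hr).2, Finset.sum_add_distrib,
    ← Finset.sum_filter, ← Finset.sum_filter, Finset.sum_const, Finset.sum_const, nsmul_eq_mul,
    nsmul_eq_mul, mul_one, mul_comm]
  congr 2
  · rw [← Set.ncard_coe_finset]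
    simp
  · congr 1
    rw [← Set.ncard_coe_finset]
    simp [SimpleGraph.properSetoids]

/-! ### Back degrees -/

/-- The number of neighbours of `m` in `g` smaller than `m`. -/
noncomputable def SimpleGraph.backDegree (g : SimpleGraph ℕ) (m : ℕ) : ℕ :=
  {j | j < m ∧ g.Adj m j}.ncard

/-- Let `j` be the largest earlier neighbour of `m`. The remaining earlier neighbours of `m` are
earlier neighbours of `j`, so the back degree of `j` is at least that of `m` minus one; induct. -/
theorem SimpleGraph.isRestrictedGrowth_backDegree (g : SimpleGraph ℕ)
    (hg : ∀ m, g.IsClique {j | j < m ∧ g.Adj m j}) : IsRestrictedGrowth g.backDegree := by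
  intro m x hx
  induction m using Nat.strong_induction_on with
  | _ m ih =>
    have hfin : ∀ m, {j | j < m ∧ g.Adj m j}.Finite := fun m =>
      (Set.finite_lt_nat m).subset fun j hj => hj.1
    have hne : {j | j < m ∧ g.Adj m j}.Nonempty :=
      (Set.ncard_pos (hfin m)).1 (Nat.zero_lt_of_lt hx)
    obtain ⟨j, hj, hmax⟩ := Set.exists_max_image _ id (hfin m) hne
    have hsub : {i | i < m ∧ g.Adj m i} \ {j} ⊆ {i | i < j ∧ g.Adj j i} := by
      rintro i ⟨hi, hij⟩
      exact ⟨lt_of_le_of_ne (hmax i hi) hij, hg m hj hi (Ne.symm hij)⟩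
    have hcard := Set.ncard_le_ncard hsub (hfin j)
    rw [Set.ncard_sdiff_singleton_of_mem hj] at hcard
    have hle : x ≤ g.backDegree j := by
      unfold SimpleGraph.backDegree at *
      omega
    rcases hle.eq_or_lt with h | h
    · exact ⟨j, hj.1, h.symm⟩
    · obtain ⟨i, hi, hix⟩ := ih j hj.1 h
      exact ⟨i, hi.trans hj.1, hix⟩

theorem SimpleGraph.ncard_properSetoids_eq_connectionCoeff (g : SimpleGraph ℕ)
    (hg : ∀ m, g.IsClique {j | j < m ∧ g.Adj m j}) (m k : ℕ) :
    (((g.comap (Fin.val : Fin m → ℕ)).properSetoids k).ncard : ℝ) =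
      connectionCoeff g.backDegree m k := by
  induction m generalizing k with
  | zero =>
    cases k with
    | zero =>
      have : (g.comap (Fin.val : Fin 0 → ℕ)).properSetoids 0 = Set.univ := by
        refine Set.eq_univ_of_forall fun r => ⟨fun x => x.elim0, ?_⟩
        have : IsEmpty (Quotient r) := ⟨fun q => q.inductionOn fun x => x.elim0⟩
        exact Nat.card_of_isEmpty
      have hu : (Set.univ : Set (Setoid (Fin 0))) = {⊥} :=
        (Set.eq_singleton_iff_unique_mem.2 ⟨trivial, fun r _ => Setoid.ext fun x => x.elim0⟩)
      rw [this, hu, Set.ncard_singleton]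
      simp [connectionCoeff]
    | succ k =>
      have : (g.comap (Fin.val : Fin 0 → ℕ)).properSetoids (k + 1) = ∅ := by
        refine Set.eq_empty_of_forall_notMem fun r hr => ?_
        have : IsEmpty (Quotient r) := ⟨fun q => q.inductionOn fun x => x.elim0⟩
        have h := hr.2
        rw [Nat.card_of_isEmpty] at h
        omega
      rw [this, Set.ncard_empty]
      simp [connectionCoeff]
  | succ m ih =>
    have hcl : (g.comap (Fin.val : Fin (m + 1) → ℕ)).IsClique
        {j | j < Fin.last m ∧ (g.comap (Fin.val : Fin (m + 1) → ℕ)).Adj (Fin.last m) j} :=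
      fun x hx y hy hxy => hg m ⟨hx.1, hx.2⟩ ⟨hy.1, hy.2⟩ (Fin.val_injective.ne hxy)
    have hdeg : {j : Fin m | (g.comap (Fin.val : Fin (m + 1) → ℕ)).Adj
        (Fin.last m) j.castSucc}.ncard = g.backDegree m := by
      rw [SimpleGraph.backDegree, ← Set.ncard_image_of_injective _ Fin.val_injective]
      congr 1
      ext j
      constructor
      · rintro ⟨i, hi, rfl⟩
        exact ⟨i.2, hi⟩
      · rintro ⟨hj, hadj⟩
        exact ⟨⟨j, hj⟩, hadj, rfl⟩
    have hcomap : (g.comap (Fin.val : Fin (m + 1) → ℕ)).comap Fin.castSucc =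
        g.comap (Fin.val : Fin m → ℕ) := rfl
    rw [SimpleGraph.ncard_properSetoids_succ _ hcl, hdeg, hcomap, ih]
    cases k with
    | zero => simp [connectionCoeff]
    | succ k =>
      rw [connectionCoeff, ← ih k]
      simp [SimpleGraph.properSetoids]

/-! ### Transport to the natural numbers and conclusion -/

/-- The graph on `ℕ` obtained by transporting a graph along an enumeration of its vertices. -/
def SimpleGraph.natTransport {V : Type*} (G : SimpleGraph V) {n : ℕ} (v : Fin n ≃ V) :
    SimpleGraph ℕ :=
  (G.comap v).map Fin.valEmbedding

theorem SimpleGraph.natTransport_adj {V : Type*} (G : SimpleGraph V) {n : ℕ} (v : Fin n ≃ V)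
    (i j : Fin n) : (G.natTransport v).Adj i j ↔ G.Adj (v i) (v j) :=
  SimpleGraph.map_adj_apply (f := Fin.valEmbedding) (G := G.comap v)

theorem SimpleGraph.natTransport_adj_lt {V : Type*} (G : SimpleGraph V) {n : ℕ} (v : Fin n ≃ V)
    {i j : ℕ} (h : (G.natTransport v).Adj i j) : i < n ∧ j < n := by
  obtain ⟨-, a, b, -, rfl, rfl⟩ := h
  exact ⟨a.2, b.2⟩

theorem SimpleGraph.IsPerfectEliminationOrder.isClique_natTransport {V : Type*}
    {G : SimpleGraph V} {n : ℕ} {v : Fin n ≃ V} (hv : G.IsPerfectEliminationOrder v) (m : ℕ) :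
    (G.natTransport v).IsClique {j | j < m ∧ (G.natTransport v).Adj m j} := by
  rintro i ⟨him, hi⟩ j ⟨hjm, hj⟩ hij
  obtain ⟨hm, hin⟩ := G.natTransport_adj_lt v hi
  obtain ⟨-, hjn⟩ := G.natTransport_adj_lt v hj
  lift m to Fin n using hm
  lift i to Fin n using hin
  lift j to Fin n using hjn
  rw [natTransport_adj] at *
  exact hv m ⟨i, ⟨him, hi⟩, rfl⟩ ⟨j, ⟨hjm, hj⟩, rfl⟩ (v.injective.ne fun h => hij (congrArg _ h))

/-- The graph on the first `m` vertices is isomorphic to its transport to `Fin m`. -/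
noncomputable def SimpleGraph.natTransportIso {V : Type*} (G : SimpleGraph V) {n : ℕ}
    (v : Fin n ≃ V) {m : ℕ} (hm : m ≤ n) :
    (G.natTransport v).comap (Fin.val : Fin m → ℕ) ≃g G.initialInduce v m where
  toEquiv := Equiv.ofBijective
    (fun i => ⟨v (i.castLE hm), i.castLE hm, i.2, rfl⟩) <| by
      constructor
      · intro i j h
        exact Fin.castLE_injective hm (v.injective (Subtype.ext_iff.1 h))
      · rintro ⟨_, i, hi, rfl⟩
        exact ⟨⟨i, hi⟩, rfl⟩
  map_rel_iff' {i j} := (G.natTransport_adj v (i.castLE hm) (j.castLE hm)).symm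

theorem SimpleGraph.IsPerfectEliminationOrder.stirlingMatrix_apply {V : Type*}
    {G : SimpleGraph V} {n : ℕ} {v : Fin n ≃ V} (hv : G.IsPerfectEliminationOrder v)
    (m k : Fin (n + 1)) :
    G.stirlingMatrix v m k = connectionCoeff (G.natTransport v).backDegree m k := by
  have : Finite V := Finite.of_equiv _ v
  rw [← SimpleGraph.ncard_properSetoids_eq_connectionCoeff _ hv.isClique_natTransport,
    (G.natTransportIso v (Nat.lt_succ_iff.1 m.2)).ncard_properSetoids,
    ← SimpleGraph.stirlingSecond_eq_ncard_properSetoids]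
  rfl

theorem theorem2p2 {V : Type*} (G : SimpleGraph V) (hG : G.IsChordal) (n : ℕ) (v : Fin n ≃ V)
    (hv : G.IsPerfectEliminationOrder v) : (G.stirlingMatrix v).IsTotallyNonneg := by
  intro l r s
  -- Vertices from `n` on are isolated, so the back degrees repeat 0 forever. Rows up to `n` use
  -- only the first `n` terms, so the tail can be replaced by one without repetitions.
  obtain ⟨b, hb, hfin, hbn⟩ := ((G.natTransport v).isRestrictedGrowth_backDegree
    hv.isClique_natTransport).exists_extension n
  convert hb.isTotallyNonnegArray_connectionCoeff hfin l (fun i => r i) (fun i => s i)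
    (fun _ _ h => r.strictMono h) (fun _ _ h => s.strictMono h) using 2
  ext i j
  rw [Matrix.submatrix_apply, hv.stirlingMatrix_apply, Matrix.of_apply]
  exact connectionCoeff_congr (fun p hp => (hbn p (by omega)).symm) _
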